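/- Let $\mathbb F_q$ be a finite field and let $P\subset \mathrm{GL}(n,\mathbb F_q)$ be the standard parabolic subgroup of block upper triangular matrices with diagonal blocks of orders $n_1,\dots,n_s$. Write $P=RN$, where $R$ is the subgroup of block diagonal matrices and $N=1+J$, with $J$ the associative algebra of strictly block upper triangular matrices. Divide $[1,n]$ into consecutive segments $I_1,\dots,I_s$ of sizes $n_1,\dots,n_s$. A block-rook is a set $A_k\times A_\ell$ with $A_k\subseteq I_k$, $A_\ell\subseteq I_\ell$, $k<\ell$, $|A_k|=|A_\ell|$; a block-rook placement $\mathbb D$ is a union of block-rooks such that each row and each column meets at most one of them. Let $\mathbb D$ be a block-rook placement and let $\lambda=\sum_{(i,j)\in\mathbb D}\lambda_{ij}E_{ij}^*\in J^*$ be a linear form associated with $\mathbb D$, i.e. for each block-rook $A_k\times A_\ell$ of $\mathbb D$ the submatrix $(\lambda_{ij})_{i\in A_k,\,j\in A_\ell}$ is nondegenerate. Put $$J_{\mathbb D,\mathrm{rt}}=\{x\in J:\ \lambda(xy)=0\ \text{for all } y\in J\},\qquad R^\circ_{\mathbb D}=\{r\in R:\ \lambda(rx)=\lambda(x)=\lambda(xr)\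 \text{for all } x\in J\},$$ and let $P_{\mathbb D}$ be the group of all $r+x$ with $r\in R^\circ_{\mathbb D}$, $x\in J_{\mathbb D,\mathrm{rt}}$. Fix a nontrivial character $t\mapsto\varepsilon^t\in\mathbb C^*$ of the additive group of $\mathbb F_q$. For a (complex) character $\theta$ of $R^\circ_{\mathbb D}$ let $\xi_{\mathbb D,\theta}(r+x)=\theta(r)\varepsilon^{\lambda(x)}$, a character of $P_{\mathbb D}$, and let $\chi_{\mathbb D,\theta}=\mathrm{Ind}(\xi_{\mathbb D,\theta},P_{\mathbb D},P)$. Let $S$ be the subgroup of all $g\in P$ such that $x\mapsto gxg^{-1}$ preserves $J_{\mathbb D,\mathrm{rt}}$ and stabilizes the restriction of $\lambda$ to $J_{\mathbb D,\mathrm{rt}}$; it acts on $R^\circ_{\mathbb D}$ by sending $r$ to the block diagonal part of $grg^{-1}$ (i.e. to $grg^{-1}$ modulo $N$). Two characters of a finite group are called disjoint if they have no common irreducible component. If $\theta$ and $\theta'$ are disjoint $S$-invariant characters of $R^\circ_{\mathbb D}$, then the characters $\chi_{\mathbb D,\theta}$ and $\chi_{\mathbb D,\theta'}$ of $P$ are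 disjoint. -/

import Mathlib

noncomputable section

namespace ParabolicSuper

/-! ### Characters of finite groups -/

section Characters

variable {G : Type*} [Group G]

/-- `φ` is the character of a finite dimensional complex representation of `G`. -/
def IsCharacter (φ : G → ℂ) : Prop :=
  ∃ (d : ℕ) (ρ : Representation ℂ G (Fin d → ℂ)), ρ.character = φ

/-- `ψ` is the character of an irreducible finite dimensional complex representation of `G`. -/
def IsIrreducibleCharacter (ψ : G → ℂ) : Prop :=
  ∃ (d : ℕ) (ρ : Representation ℂ G (Fin d → ℂ)), ρ.IsIrreducible ∧ ρ.character = ψ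

/-- The multiplicity `(1 / |G|) ∑ g, χ g * ψ (g⁻¹)` of an irreducible character `ψ` of a finite
group in `χ`; here `ψ (g⁻¹)` is the complex conjugate of `ψ g`. -/
def irrMultiplicity (ψ χ : G → ℂ) : ℂ :=
  (Nat.card G : ℂ)⁻¹ * ∑ᶠ g : G, χ g * ψ g⁻¹

/-- The support of a character: the set of its irreducible components. -/
def irrSupport (χ : G → ℂ) : Set (G → ℂ) :=
  {ψ | IsIrreducibleCharacter ψ ∧ irrMultiplicity ψ χ ≠ 0}

/-- Two characters are disjoint if they have no common irreducible component. -/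
def DisjointCharacters (χ χ' : G → ℂ) : Prop :=
  Disjoint (irrSupport χ) (irrSupport χ')

open Classical in
/-- The character of the finite group `G` induced by a character `φ` of the subgroup `H`. -/
def inducedCharacter (H : Subgroup G) (φ : H → ℂ) (g : G) : ℂ :=
  (Nat.card H : ℂ)⁻¹ * ∑ᶠ s : G, if h : s⁻¹ * g * s ∈ H then φ ⟨s⁻¹ * g * s, h⟩ else 0

end Characters

/-! ### The parabolic subgroup attached to a composition of `n` -/

section Parabolic

variable {n : ℕ} (c : Composition n) (F : Type*) [Field F]

/-- The standard parabolic subgroup of block upper triangular matrices, with diagonal blocks of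
orders given by the parts of the composition `c`. -/
def parabolic : Subgroup (Matrix.GeneralLinearGroup (Fin n) F) where
  carrier := {g | (g : Matrix (Fin n) (Fin n) F).BlockTriangular c.index}
  mul_mem' {a b} ha hb := by
    simp only [Set.mem_ofPred_eq, Units.val_mul] at *
    exact ha.mul hb
  one_mem' := by
    simp only [Set.mem_ofPred_eq, Units.val_one]
    exact Matrix.blockTriangular_one
  inv_mem' {a} ha := by
    simp only [Set.mem_ofPred_eq] at *
    rw [Matrix.coe_units_inv]
    have := a.invertible
    exact Matrix.blockTriangular_inv_of_blockTriangular ha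

/-- The group `P`. -/
abbrev P : Type _ := parabolic c F

/-- The associative algebra `J` of strictly block upper triangular matrices. -/
def J : NonUnitalSubalgebra F (Matrix (Fin n) (Fin n) F) where
  carrier := {x | ∀ i j, c.index j ≤ c.index i → x i j = 0}
  add_mem' {x y} hx hy i j h := by simp [hx i j h, hy i j h]
  zero_mem' _ _ _ := rfl
  smul_mem' a x hx i j h := by simp [hx i j h]
  mul_mem' {x y} hx hy i j h := by
    rw [Matrix.mul_apply]
    refine Finset.sum_eq_zero fun k _ => ?_
    rcases le_total (c.index k) (c.index i) with hk | hk
    · rw [hx i k hk, zero_mul]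
    · rw [hy k j (h.trans hk), mul_zero]

variable {c F}

/-- The matrix of an element of `P`. -/
def P.mat (g : P c F) : Matrix (Fin n) (Fin n) F :=
  ((g : Matrix.GeneralLinearGroup (Fin n) F) : Matrix (Fin n) (Fin n) F)

@[simp] lemma P.mat_mul (g h : P c F) : (g * h).mat = g.mat * h.mat := rfl

@[simp] lemma P.mat_one : (1 : P c F).mat = 1 := rfl

lemma P.mat_mul_inv (g : P c F) : g.mat * g⁻¹.mat = 1 := by
  rw [← P.mat_mul, mul_inv_cancel, P.mat_one]

lemma P.mat_inv_mul (g : P c F) : g⁻¹.mat * g.mat = 1 := by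
  rw [← P.mat_mul, inv_mul_cancel, P.mat_one]

lemma P.mat_apply_eq_zero (g : P c F) {i j : Fin n} (h : c.index j < c.index i) :
    g.mat i j = 0 := g.2 h

/-- Left multiplication `x ↦ g x` by an element of `P` on `J`. -/
def lmul (g : P c F) : J c F →ₗ[F] J c F where
  toFun x := ⟨g.mat * (x : Matrix (Fin n) (Fin n) F), fun i j h => by
    rw [Matrix.mul_apply]
    refine Finset.sum_eq_zero fun k _ => ?_
    rcases lt_or_ge (c.index k) (c.index i) with hk | hk
    · rw [g.mat_apply_eq_zero hk, zero_mul]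
    · rw [x.2 k j (h.trans hk), mul_zero]⟩
  map_add' x y := Subtype.ext (Matrix.mul_add _ _ _)
  map_smul' a x := Subtype.ext (Matrix.mul_smul _ _ _)

/-- Right multiplication `x ↦ x g` by an element of `P` on `J`. -/
def rmul (g : P c F) : J c F →ₗ[F] J c F where
  toFun x := ⟨(x : Matrix (Fin n) (Fin n) F) * g.mat, fun i j h => by
    rw [Matrix.mul_apply]
    refine Finset.sum_eq_zero fun k _ => ?_
    rcases le_or_gt (c.index k) (c.index i) with hk | hk
    · rw [x.2 i k hk, zero_mul]
    · rw [g.mat_apply_eq_zero (h.trans_lt hk), mul_zero]⟩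
  map_add' x y := Subtype.ext (Matrix.add_mul _ _ _)
  map_smul' a x := Subtype.ext (Matrix.smul_mul _ _ _)

@[simp] lemma coe_lmul (g : P c F) (x : J c F) :
    (lmul g x : Matrix (Fin n) (Fin n) F) = g.mat * (x : Matrix (Fin n) (Fin n) F) := rfl

@[simp] lemma coe_rmul (g : P c F) (x : J c F) :
    (rmul g x : Matrix (Fin n) (Fin n) F) = (x : Matrix (Fin n) (Fin n) F) * g.mat := rfl

/-- The adjoint action `x ↦ g x g⁻¹` of `P` on `J`. -/
def Ad (g : P c F) : J c F →ₗ[F] J c F := lmul g ∘ₗ rmul g⁻¹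

@[simp] lemma coe_Ad (g : P c F) (x : J c F) :
    (Ad g x : Matrix (Fin n) (Fin n) F)
      = g.mat * ((x : Matrix (Fin n) (Fin n) F) * g⁻¹.mat) := rfl

/-- The left action `(g l)(x) = l (x g)` of `P` on the dual space of `J`. -/
def leftAct (g : P c F) (l : Module.Dual F (J c F)) : Module.Dual F (J c F) := l ∘ₗ rmul g

/-- The right action `(l g)(x) = l (g x)` of `P` on the dual space of `J`. -/
def rightAct (l : Module.Dual F (J c F)) (g : P c F) : Module.Dual F (J c F) := l ∘ₗ lmul g

variable (c F) in
/-- The subgroup `R` of `P` of block diagonal matrices. -/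
def R : Subgroup (P c F) where
  carrier := {g | ∀ i j, c.index i ≠ c.index j → g.mat i j = 0}
  mul_mem' {a b} ha hb i j h := by
    rw [P.mat_mul, Matrix.mul_apply]
    refine Finset.sum_eq_zero fun k _ => ?_
    by_cases hk : c.index i = c.index k
    · rw [hb k j (hk ▸ h), mul_zero]
    · rw [ha i k hk, zero_mul]
  one_mem' i j h := by
    rw [P.mat_one, Matrix.one_apply_ne (fun e => h (congrArg _ e))]
  inv_mem' {a} ha i j h := by
    rcases lt_or_gt_of_ne h with h | h
    · have h1 : (a.mat).BlockTriangular (OrderDual.toDual ∘ c.index) :=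
        fun i j hij => ha i j (ne_of_lt (OrderDual.toDual_lt_toDual.1 hij))
      have : Invertible a.mat := (a : Matrix.GeneralLinearGroup (Fin n) F).invertible
      have h2 := Matrix.blockTriangular_inv_of_blockTriangular h1
      have h3 : a⁻¹.mat = (a.mat)⁻¹ :=
        Matrix.coe_units_inv (a : Matrix.GeneralLinearGroup (Fin n) F)
      rw [h3]
      exact h2 (OrderDual.toDual_lt_toDual.2 h)
    · exact P.mat_apply_eq_zero _ h

/-! ### Subgroups attached to a linear form on `J` -/

/-- The algebra of all `x` in `J` with `l (x y) = 0` for all `y` in `J`; the stabilizer of `l` in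
`1 + J`, acting on the right, is `1 + Jrt l`. -/
def Jrt (l : Module.Dual F (J c F)) : Submodule F (J c F) where
  carrier := {x | ∀ y : J c F, l (x * y) = 0}
  add_mem' {x y} hx hy z := by rw [add_mul, map_add, hx z, hy z, add_zero]
  zero_mem' z := by rw [zero_mul, map_zero]
  smul_mem' a x hx z := by rw [smul_mul_assoc, map_smul, hx z, smul_zero]

/-- The stabilizer in `R` of `l` under the right action. -/
def Rrt (l : Module.Dual F (J c F)) : Subgroup (P c F) where
  carrier := {r | r ∈ R c F ∧ rightAct l r = l}
  mul_mem' {a b} ha hb := by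
    refine ⟨mul_mem ha.1 hb.1, LinearMap.ext fun x => ?_⟩
    have h1 := LinearMap.congr_fun ha.2 (lmul b x)
    have h2 := LinearMap.congr_fun hb.2 x
    have h3 : lmul (a * b) x = lmul a (lmul b x) := Subtype.ext (by simp [Matrix.mul_assoc])
    simp only [rightAct, LinearMap.comp_apply] at *
    rw [h3, h1, h2]
  one_mem' := ⟨one_mem _, LinearMap.ext fun x => congrArg l (Subtype.ext (by simp))⟩
  inv_mem' {a} ha := by
    refine ⟨inv_mem ha.1, LinearMap.ext fun x => ?_⟩
    have h1 := LinearMap.congr_fun ha.2 (lmul a⁻¹ x)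
    have h3 : lmul a (lmul a⁻¹ x) = x := Subtype.ext (by
      simp [← Matrix.mul_assoc, P.mat_mul_inv])
    simp only [rightAct, LinearMap.comp_apply] at *
    rw [← h1, h3]

/-- The stabilizer in `R` of `l` under the left action. -/
def Rlt (l : Module.Dual F (J c F)) : Subgroup (P c F) where
  carrier := {r | r ∈ R c F ∧ leftAct r l = l}
  mul_mem' {a b} ha hb := by
    refine ⟨mul_mem ha.1 hb.1, LinearMap.ext fun x => ?_⟩
    have h1 := LinearMap.congr_fun ha.2 x
    have h2 := LinearMap.congr_fun hb.2 (rmul a x)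
    have h3 : rmul (a * b) x = rmul b (rmul a x) := Subtype.ext (by simp [Matrix.mul_assoc])
    simp only [leftAct, LinearMap.comp_apply] at *
    rw [h3, h2, h1]
  one_mem' := ⟨one_mem _, LinearMap.ext fun x => congrArg l (Subtype.ext (by simp))⟩
  inv_mem' {a} ha := by
    refine ⟨inv_mem ha.1, LinearMap.ext fun x => ?_⟩
    have h1 := LinearMap.congr_fun ha.2 (rmul a⁻¹ x)
    have h3 : rmul a (rmul a⁻¹ x) = x := Subtype.ext (by
      simp [Matrix.mul_assoc, P.mat_inv_mul])
    simp only [leftAct, LinearMap.comp_apply] at *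
    rw [← h1, h3]

/-- The subgroup `R° = Rrt ∩ Rlt`. -/
def Rcirc (l : Module.Dual F (J c F)) : Subgroup (P c F) := Rrt l ⊓ Rlt l

lemma rmul_mem_Jrt {l : Module.Dual F (J c F)} (g : P c F) {x : J c F} (hx : x ∈ Jrt l) :
    rmul g x ∈ Jrt l := fun y => by
  have h : rmul g x * y = x * lmul g y := Subtype.ext (by simp [Matrix.mul_assoc])
  rw [h]
  exact hx _

lemma lmul_mem_Jrt {l : Module.Dual F (J c F)} {r : P c F} (hr : r ∈ Rcirc l) {x : J c F}
    (hx : x ∈ Jrt l) : lmul r x ∈ Jrt l := fun y => by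
  have h : lmul r x * y = lmul r (x * y) := Subtype.ext (by simp [Matrix.mul_assoc])
  rw [h]
  exact (LinearMap.congr_fun hr.1.2 (x * y)).trans (hx y)

/-- The subgroup of all `r + x` with `r` in `R°` and `x` in `Jrt l`. -/
def PD (l : Module.Dual F (J c F)) : Subgroup (P c F) where
  carrier := {g | ∃ (r : Rcirc l) (x : Jrt l),
    g.mat = (r : P c F).mat + ((x : J c F) : Matrix (Fin n) (Fin n) F)}
  mul_mem' := by
    rintro a b ⟨r, x, ha⟩ ⟨s, y, hb⟩
    refine ⟨r * s, ⟨lmul (r : P c F) y + rmul b x,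
      add_mem (lmul_mem_Jrt r.2 y.2) (rmul_mem_Jrt b x.2)⟩, ?_⟩
    simp only [P.mat_mul, ha, hb, Subgroup.coe_mul, NonUnitalSubalgebra.coe_add, coe_lmul,
      coe_rmul, Matrix.add_mul, Matrix.mul_add]
    abel
  one_mem' := ⟨1, 0, by simp⟩
  inv_mem' := by
    rintro a ⟨r, x, ha⟩
    refine ⟨r⁻¹, ⟨-lmul (r⁻¹ : Rcirc l) (rmul a⁻¹ (x : J c F)),
      neg_mem (lmul_mem_Jrt (r⁻¹ : Rcirc l).2 (rmul_mem_Jrt a⁻¹ x.2))⟩, ?_⟩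
    have h1 : (x : J c F).1 = a.mat - (r : P c F).mat := by rw [ha]; simp
    have h2 : (r : P c F)⁻¹.mat * (a.mat * a⁻¹.mat) = (r : P c F)⁻¹.mat := by
      rw [P.mat_mul_inv, mul_one]
    have h3 : (r : P c F)⁻¹.mat * ((r : P c F).mat * a⁻¹.mat) = a⁻¹.mat := by
      rw [← Matrix.mul_assoc, P.mat_inv_mul, one_mul]
    simp only [NonUnitalSubalgebra.coe_neg, coe_lmul, coe_rmul, Subgroup.coe_inv, h1,
      Matrix.sub_mul, Matrix.mul_sub, h2, h3]
    abel

/-- The decomposition `g = r + x` of an element of `PD l` is unique. -/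
lemma decomposition_unique {l : Module.Dual F (J c F)} {s r : Rcirc l} {y x : Jrt l}
    (h : (s : P c F).mat + ((y : J c F) : Matrix (Fin n) (Fin n) F)
      = (r : P c F).mat + ((x : J c F) : Matrix (Fin n) (Fin n) F)) : s = r ∧ y = x := by
  have key : ∀ i j, (s : P c F).mat i j + (y : J c F).1 i j
      = (r : P c F).mat i j + (x : J c F).1 i j := fun i j => congrFun (congrFun h i) j
  have hs : s = r := by
    refine Subtype.ext (Subtype.ext (Units.ext (Matrix.ext fun i j => ?_)))
    change (s : P c F).mat i j = (r : P c F).mat i j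
    by_cases hij : c.index i = c.index j
    · have := key i j
      rwa [(y : J c F).2 i j hij.ge, (x : J c F).2 i j hij.ge, add_zero, add_zero] at this
    · rw [s.2.1.1 i j hij, r.2.1.1 i j hij]
  refine ⟨hs, Subtype.ext (Subtype.ext (Matrix.ext fun i j => ?_))⟩
  have := key i j
  rw [hs] at this
  exact add_left_cancel this

/-- The character `r + x ↦ θ r * ε (l x)` of the group `PD l`. -/
def xi (ε : AddChar F ℂ) (l : Module.Dual F (J c F)) (θ : Rcirc l → ℂ) (g : PD l) : ℂ :=
  θ g.2.choose * ε (l (g.2.choose_spec.choose : J c F))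

/-- The value of `xi` does not depend on choices: the decomposition `g = r + x` is unique. -/
lemma xi_eq (ε : AddChar F ℂ) (l : Module.Dual F (J c F)) (θ : Rcirc l → ℂ) (g : PD l)
    (r : Rcirc l) (x : Jrt l)
    (h : (g : P c F).mat = (r : P c F).mat + ((x : J c F) : Matrix (Fin n) (Fin n) F)) :
    xi ε l θ g = θ r * ε (l (x : J c F)) := by
  have h' := g.2.choose_spec.choose_spec
  obtain ⟨hs, hxy⟩ := decomposition_unique (h'.symm.trans h)
  exact congrArg₂ (fun (a : Rcirc l) (b : Jrt l) => θ a * ε (l (b : J c F))) hs hxy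

/-- The character of `P` induced by the character `xi` of `PD l`. -/
def chi (ε : AddChar F ℂ) (l : Module.Dual F (J c F)) (θ : Rcirc l → ℂ) : P c F → ℂ :=
  inducedCharacter (PD l) (xi ε l θ)

/-- The subgroup `S` of all `g` in `P` whose adjoint action preserves `Jrt l` and stabilizes the
restriction of `l` to it. -/
def S (l : Module.Dual F (J c F)) : Subgroup (P c F) where
  carrier := {g | (∀ x : J c F, Ad g x ∈ Jrt l ↔ x ∈ Jrt l) ∧ ∀ x ∈ Jrt l, l (Ad g x) = l x}
  mul_mem' {a b} ha hb := by
    have h : ∀ x : J c F, Ad (a * b) x = Ad a (Ad b x) := fun x =>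
      Subtype.ext (by simp [Matrix.mul_assoc])
    refine ⟨fun x => ?_, fun x hx => ?_⟩
    · rw [h, ha.1, hb.1]
    · rw [h, ha.2 _ ((hb.1 x).2 hx), hb.2 x hx]
  one_mem' := by
    have h : ∀ x : J c F, Ad 1 x = x := fun x => Subtype.ext (by simp)
    exact ⟨fun x => by rw [h], fun x _ => by rw [h]⟩
  inv_mem' {a} ha := by
    have h : ∀ x : J c F, Ad a (Ad a⁻¹ x) = x := fun x => Subtype.ext (by
      have h1 : a.mat * (a⁻¹.mat * ((x.1 * a.mat) * a⁻¹.mat)) = x.1 := by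
        rw [Matrix.mul_assoc x.1, P.mat_mul_inv, mul_one, ← Matrix.mul_assoc, P.mat_mul_inv,
          one_mul]
      simpa [Matrix.mul_assoc] using h1)
    have h1 : ∀ x : J c F, Ad a⁻¹ x ∈ Jrt l ↔ x ∈ Jrt l := fun x => by
      rw [← ha.1 (Ad a⁻¹ x), h]
    exact ⟨h1, fun x hx => by rw [← ha.2 _ ((h1 x).2 hx), h]⟩

/-- A function on `R°` is `S`-invariant if it is invariant under the action of `S` on `R°`, in which
`g` sends `r` to the element `r'` of `R°` congruent to `g r g⁻¹` modulo `1 + J`, that is, to the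
block diagonal part of `g r g⁻¹`. -/
def SInvariant (l : Module.Dual F (J c F)) (θ : Rcirc l → ℂ) : Prop :=
  ∀ g ∈ S l, ∀ r r' : Rcirc l, (g * (r : P c F) * g⁻¹).mat - (r' : P c F).mat ∈ J c F →
    θ r' = θ r

/-! ### Block-rook placements -/

variable (c) in
/-- A block-rook placement: a finite set of block-rooks `A × B` that do not attack each other.
Each block-rook lies in a single block above the diagonal and satisfies `|A| = |B|`. -/
structure BlockRookPlacement where
  /-- The pairs `(A, B)`, one for each block-rook `A × B`. -/
  rooks : Finset (Finset (Fin n) × Finset (Fin n))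
  isBlockRook : ∀ p ∈ rooks, p.1.card = p.2.card ∧
    ∃ k m : Fin c.length, k < m ∧ (∀ i ∈ p.1, c.index i = k) ∧ ∀ j ∈ p.2, c.index j = m
  nonattacking : ∀ p ∈ rooks, ∀ q ∈ rooks, p ≠ q → Disjoint p.1 q.1 ∧ Disjoint p.2 q.2

/-- The set of positions covered by a block-rook placement. -/
def BlockRookPlacement.roots (D : BlockRookPlacement c) : Finset (Fin n × Fin n) :=
  D.rooks.biUnion fun p => p.1 ×ˢ p.2

/-- A linear form `l = ∑ a i j E*_{i j}`, the sum over the positions `(i, j)` of the placement, is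
associated with the placement if the coefficients form a nondegenerate matrix on each block-rook. -/
def IsAssociated (D : BlockRookPlacement c) (l : Module.Dual F (J c F)) : Prop :=
  ∃ a : Matrix (Fin n) (Fin n) F,
    (∀ x : J c F, l x = ∑ p ∈ D.roots, a p.1 p.2 * (x : Matrix (Fin n) (Fin n) F) p.1 p.2) ∧
    ∀ p ∈ D.rooks,
      (a.submatrix (fun i : p.1 => (i : Fin n)) (fun j : p.2 => (j : Fin n))).Nondegenerate

end Parabolic

end ParabolicSuper

end

/-!
The proof multiplies operators instead of computing inner products of characters. For a function `φ`
on a finite group `G` and a representation `ρ` put `ρ(φ) = ∑ g, φ g • ρ (g⁻¹)`. If `ρ` is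
irreducible and `φ` is a class function, then by Schur's lemma `ρ(φ)` is a scalar, which vanishes
exactly when the character of `ρ` has multiplicity zero in `φ`. So it is enough to show that the
operators of the two induced characters multiply to zero in every irreducible representation of `P`
(`disjointCharacters_of_mul_eq_zero`). The operator of an induced character is an average of
conjugates, so this reduces to `A * ρ g * A' = 0` for all `g` in `P`, where `A` and `A'` are the
operators of the two characters `xi` of `PD l`, extended by zero.

If `g` does not lie in `S l`, there is an `x` in `Jrt l` with `g x g⁻¹` in `Jrt l` on which the form
`l` and its translate by `g` differ (`mem_S_of_forall`). This is linear duality: the forms vanishing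
on `Jrt l` are the forms `x ↦ l (x y)` with `y` in `J`, so if `l` and its translate agreed on the
intersection of `Jrt l` with its conjugate, the orbits of the two forms under left translation by
`1 + J` would meet, and then `g` would lie in `S l`. The elements `1 + x` and `1 + g x g⁻¹` act on
`A'` and `A` by different scalars after rescaling `x`, which forces `A * ρ g * A' = 0`.

If `g` lies in `S l`, then conjugation by `g` preserves `PD l` and `xi`, so that `ρ g` commutes with
`A'`. This is where the block-rooks enter: writing `l x = trace (L x)`, the nonzero entries of each
row and of each column of `L` lie in one block, and this makes the kernel and the image of `L`
invariant under the block diagonal part `s` of `g`. As `R°` consists of the `1 + f` with `f` block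
diagonal and `L f = f L = 0`, it is normalized by `s`; moreover, `g r g⁻¹ - s r s⁻¹` lies in `Jrt l`
and is killed by `l` for `r` in `R°` (`exists_conj_eq`). Finally `A * A' = 0`, since disjoint
characters of `R°` have zero convolution (`sum_mul_eq_zero_of_disjoint`): averaging any linear map
between the two representations gives an intertwining map, which must be zero.
-/

noncomputable section

namespace ParabolicSuper

/-! ### Operators attached to functions on a finite group -/

section CharacterTheory

variable {G : Type*} [Group G]

/-- The operator `∑ g, φ g • ρ (g⁻¹)` attached to a function `φ` on a finite group. -/
def funOperator [Fintype G] {V : Type*} [AddCommGroup V] [Module ℂ V] (ρ : Representation ℂ G V)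
    (φ : G → ℂ) : Module.End ℂ V :=
  ∑ g, φ g • ρ g⁻¹

open Classical in
/-- The extension by zero to `G` of a function on a subgroup. -/
def extendZero (H : Subgroup G) (φ : H → ℂ) (g : G) : ℂ :=
  if h : g ∈ H then φ ⟨g, h⟩ else 0

lemma extendZero_of_mem {H : Subgroup G} {φ : H → ℂ} (h : H) : extendZero H φ h = φ h := by
  simp [extendZero]

lemma extendZero_of_notMem {H : Subgroup G} {φ : H → ℂ} {g : G} (h : g ∉ H) :
    extendZero H φ g = 0 := by
  simp [extendZero, h]

section Operators

variable [Fintype G] {V : Type*} [AddCommGroup V] [Module ℂ V] (ρ : Representation ℂ G V)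

lemma rep_mul_funOperator (φ : G → ℂ) (u : G) :
    ρ u * funOperator ρ φ = funOperator ρ fun g => φ (g * u) := by
  simp only [funOperator, Finset.mul_sum, mul_smul_comm, ← map_mul]
  exact Fintype.sum_equiv (Equiv.mulRight u⁻¹) _ _ fun g => by simp

lemma funOperator_mul_rep (φ : G → ℂ) (u : G) :
    funOperator ρ φ * ρ u = funOperator ρ fun g => φ (u * g) := by
  simp only [funOperator, Finset.sum_mul, smul_mul_assoc, ← map_mul]
  exact Fintype.sum_equiv (Equiv.mulLeft u⁻¹) _ _ fun g => by simp

lemma funOperator_smul (a : ℂ) (φ : G → ℂ) :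
    funOperator ρ (fun g => a * φ g) = a • funOperator ρ φ := by
  simp only [funOperator, Finset.smul_sum, mul_smul]

lemma funOperator_mul (φ ψ : G → ℂ) :
    funOperator ρ φ * funOperator ρ ψ = funOperator ρ fun m => ∑ k, ψ k * φ (k⁻¹ * m) := by
  simp only [funOperator, Finset.sum_smul]
  rw [Finset.mul_sum, Finset.sum_comm]
  refine Finset.sum_congr rfl fun k _ => ?_
  rw [Finset.sum_mul]
  refine Fintype.sum_equiv (Equiv.mulLeft k) _ _ fun h => ?_
  simp only [Equiv.coe_mulLeft, inv_mul_cancel_left, mul_inv_rev, map_mul]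
  rw [smul_mul_smul_comm, mul_comm (φ h)]

lemma funOperator_zero : funOperator ρ (fun _ => 0) = 0 := by simp [funOperator]

lemma trace_funOperator (φ : G → ℂ) :
    LinearMap.trace ℂ V (funOperator ρ φ) = ∑ g, φ g * ρ.character g⁻¹ := by
  simp [funOperator, Representation.character]

/-- The operator of an induced character is an average of conjugates. -/
lemma funOperator_inducedCharacter (H : Subgroup G) (φ : H → ℂ) :
    funOperator ρ (inducedCharacter H φ) =
      (Nat.card H : ℂ)⁻¹ • ∑ s, ρ s * funOperator ρ (extendZero H φ) * ρ s⁻¹ := by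
  have h : ∀ g, inducedCharacter H φ g
      = (Nat.card H : ℂ)⁻¹ * ∑ s, extendZero H φ (s⁻¹ * g * s) := fun g => by
    rw [inducedCharacter, finsum_eq_sum_of_fintype]
    rfl
  rw [funext h, funOperator_smul]
  congr 1
  simp only [rep_mul_funOperator, funOperator_mul_rep]
  simp only [funOperator, Finset.sum_smul]
  rw [Finset.sum_comm]

/-- If the operators of `φ` and `φ'` multiply to zero even after inserting an arbitrary group
element between them, then the operators of the induced characters multiply to zero. -/
lemma funOperator_inducedCharacter_mul_eq_zero (H : Subgroup G) (φ φ' : H → ℂ)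
    (h : ∀ g, funOperator ρ (extendZero H φ) * ρ g * funOperator ρ (extendZero H φ') = 0) :
    funOperator ρ (inducedCharacter H φ) * funOperator ρ (inducedCharacter H φ') = 0 := by
  rw [funOperator_inducedCharacter, funOperator_inducedCharacter, smul_mul_smul_comm,
    Finset.sum_mul_sum]
  convert smul_zero _
  refine Finset.sum_eq_zero fun s _ => Finset.sum_eq_zero fun t _ => ?_
  have := h (s⁻¹ * t)
  rw [map_mul] at this
  calc _ = ρ s * (funOperator ρ (extendZero H φ) * (ρ s⁻¹ * ρ t) *
        funOperator ρ (extendZero H φ')) * ρ t⁻¹ := by simp only [mul_assoc]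
    _ = 0 := by rw [this, mul_zero, zero_mul]

lemma inducedCharacter_mul_comm (H : Subgroup G) (φ : H → ℂ) (g u : G) :
    inducedCharacter H φ (g * u) = inducedCharacter H φ (u * g) := by
  rw [inducedCharacter, inducedCharacter, finsum_eq_sum_of_fintype, finsum_eq_sum_of_fintype]
  congr 1
  refine Fintype.sum_equiv (Equiv.mulLeft u) _ _ fun s => ?_
  change extendZero H φ (s⁻¹ * (g * u) * s) = extendZero H φ ((u * s)⁻¹ * (u * g) * (u * s))
  congr 1
  group

/-- By Schur's lemma a class function acts on an irreducible representation as a scalar; the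
scalar is nonzero if the function has nonzero multiplicity pairing with the character. -/
lemma exists_funOperator_eq_smul [FiniteDimensional ℂ V] [ρ.IsIrreducible] {φ : G → ℂ}
    (hφ : ∀ g u, φ (g * u) = φ (u * g)) (h : irrMultiplicity ρ.character φ ≠ 0) :
    ∃ a : ℂ, a ≠ 0 ∧ funOperator ρ φ = a • (1 : Module.End ℂ V) := by
  let f : Representation.IntertwiningMap ρ ρ :=
    (funOperator ρ φ).intertwiningMap_of_isIntertwiningMap ρ ρ fun g v => by
      have : funOperator ρ φ * ρ g = ρ g * funOperator ρ φ := by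
        rw [rep_mul_funOperator, funOperator_mul_rep]
        exact congrArg _ (funext fun k => hφ g k)
      exact LinearMap.congr_fun this v
  obtain ⟨a, ha⟩ :=
    (Representation.IsIrreducible.algebraMap_intertwiningMap_bijective_of_isAlgClosed
      (ρ := ρ)).2 f
  have ha' : funOperator ρ φ = a • (1 : Module.End ℂ V) := by
    refine LinearMap.ext fun v => ?_
    have := congrArg (fun F : Representation.IntertwiningMap ρ ρ => F v) ha
    exact this.symm
  refine ⟨a, ?_, ha'⟩
  rintro rfl
  apply h
  rw [irrMultiplicity, finsum_eq_sum_of_fintype, ← trace_funOperator, ha']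
  simp

/-- Two class functions whose operators multiply to zero in every irreducible representation have
no common irreducible component. -/
lemma disjointCharacters_of_mul_eq_zero {φ φ' : G → ℂ}
    (hφ : ∀ g u, φ (g * u) = φ (u * g)) (hφ' : ∀ g u, φ' (g * u) = φ' (u * g))
    (h : ∀ (d : ℕ) (ρ : Representation ℂ G (Fin d → ℂ)), ρ.IsIrreducible →
      funOperator ρ φ * funOperator ρ φ' = 0) : DisjointCharacters φ φ' := by
  rw [DisjointCharacters, Set.disjoint_left]
  rintro _ ⟨⟨d, ρ, hρ, rfl⟩, h1⟩ ⟨-, h2⟩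
  obtain ⟨a, ha, hA⟩ := exists_funOperator_eq_smul ρ hφ h1
  obtain ⟨b, hb, hB⟩ := exists_funOperator_eq_smul ρ hφ' h2
  have h0 := h d ρ hρ
  rw [hA, hB, smul_mul_smul_comm, one_mul, smul_eq_zero] at h0
  have h1 : (1 : Module.End ℂ (Fin d → ℂ)) = 0 := h0.resolve_left (mul_ne_zero ha hb)
  have hv : ∀ v : Fin d → ℂ, v = 0 := fun v => LinearMap.congr_fun h1 v
  refine bot_ne_top (α := Subrepresentation ρ) (SetLike.ext fun v => ?_)
  rw [hv v]
  exact ⟨fun _ => zero_mem (⊤ : Submodule ℂ (Fin d → ℂ)),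
    fun _ => zero_mem (⊥ : Submodule ℂ (Fin d → ℂ))⟩

end Operators

/-! ### Intertwining maps and disjoint characters -/

section Disjoint

open Representation

lemma isAtomic_subrepresentation [Finite G] {V : Type*} [AddCommGroup V] [Module ℂ V]
    (σ : Representation ℂ G V) : IsAtomic (Subrepresentation σ) := by
  have : NeZero (Nat.card G : ℂ) := ⟨Nat.cast_ne_zero.2 Nat.card_pos.ne'⟩
  have : IsSemisimpleModule (MonoidAlgebra ℂ G) σ.asModule := inferInstance
  exact (OrderIso.isAtomic_iff Subrepresentation.subrepresentationSubmoduleOrderIso).2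
    inferInstance

/-- A nonzero intertwining map is injective on some irreducible subrepresentation. -/
lemma exists_isIrreducible_of_intertwiningMap [Finite G] {V W : Type*}
    [AddCommGroup V] [Module ℂ V] [FiniteDimensional ℂ V] [AddCommGroup W] [Module ℂ W]
    {σ : Representation ℂ G V} {τ : Representation ℂ G W}
    (f : IntertwiningMap σ τ) (hf : f ≠ 0) :
    ∃ (d : ℕ) (π : Representation ℂ G (Fin d → ℂ)) (j : IntertwiningMap π σ),
      π.IsIrreducible ∧ j ≠ 0 ∧ f.comp j ≠ 0 := by
  have : NeZero (Nat.card G : ℂ) := ⟨Nat.cast_ne_zero.2 Nat.card_pos.ne'⟩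
  have := isAtomic_subrepresentation σ
  obtain ⟨C, hC⟩ := exists_isCompl f.ker
  have hC0 : C ≠ ⊥ := by
    rintro rfl
    have h : f.ker = ⊤ := by simpa using hC.sup_eq_top
    refine hf (IntertwiningMap.ext (LinearMap.ext fun v => ?_))
    have hv : v ∈ f.ker := h ▸ (Submodule.mem_top : v ∈ (⊤ : Submodule ℂ V))
    exact hv
  obtain ⟨T, hT, hTC⟩ := (IsAtomic.eq_bot_or_exists_atom_le C).resolve_left hC0
  let e := (Module.finBasis ℂ T.toSubmodule).equivFun
  let π : Representation ℂ G (Fin (Module.finrank ℂ T.toSubmodule) → ℂ) :=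
    { toFun g := e.conj (T.toRepresentation g)
      map_one' := by rw [map_one]; exact e.conj_id
      map_mul' a b := by rw [map_mul]; exact e.conj_comp _ _ }
  have hinj : ∀ v, (e.symm v : V) = 0 → v = 0 := fun v hv => by
    simpa using hv
  let j : IntertwiningMap π σ :=
    (T.toSubmodule.subtype ∘ₗ e.symm.toLinearMap).intertwiningMap_of_isIntertwiningMap π σ
      fun g v => by
        simp [π, LinearEquiv.conj_apply]
        rfl
  have hj : ∀ v, j v = (e.symm v : V) := fun v => rfl
  have hjT : ∀ v, j v ∈ T := fun v => (e.symm v).2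
  have hT' : ∃ v : Fin (Module.finrank ℂ T.toSubmodule) → ℂ, v ≠ 0 := by
    by_contra! h
    refine hT.1 (le_bot_iff.1 fun t ht => ?_)
    have : (⟨t, ht⟩ : T.toSubmodule) = 0 := by
      rw [← e.symm_apply_apply ⟨t, ht⟩, h (e ⟨t, ht⟩), map_zero]
    exact congrArg Subtype.val this
  obtain ⟨v₀, hv₀⟩ := hT'
  refine ⟨_, π, j, ?_, ?_, ?_⟩
  · refine { exists_pair_ne := ⟨⊥, ⊤, fun h => hv₀ ?_⟩, eq_bot_or_eq_top := fun Q => ?_ }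
    · have : v₀ ∈ (⊥ : Subrepresentation π) := h ▸ (Submodule.mem_top : v₀ ∈ (⊤ : Submodule ℂ _))
      exact this
    · let Q' : Subrepresentation σ :=
        { toSubmodule := Q.toSubmodule.map j.toLinearMap
          apply_mem_toSubmodule := by
            rintro g _ ⟨v, hv, rfl⟩
            exact ⟨π g v, Q.apply_mem_toSubmodule g hv, j.isIntertwining _ _ g v⟩ }
      have hQ' : Q' ≤ T := by
        rintro _ ⟨v, -, rfl⟩
        exact hjT v
      rcases hT.le_iff.1 hQ' with h | h
      · refine Or.inl (le_bot_iff.1 fun v hv => hinj v ?_)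
        have : j v ∈ Q' := ⟨v, hv, rfl⟩
        rw [h] at this
        exact this
      · refine Or.inr (top_le_iff.1 fun v _ => ?_)
        have hv : j v ∈ Q' := by rw [h]; exact hjT v
        obtain ⟨w, hw, hwv⟩ := hv
        have hwv' : w = v := e.symm.injective (Subtype.ext hwv)
        exact hwv' ▸ hw
  · intro h
    exact hv₀ (hinj v₀ (congrArg (fun F : IntertwiningMap π σ => F v₀) h))
  · intro h
    have h1 : f (j v₀) = 0 := congrArg (fun F : IntertwiningMap π τ => F v₀) h
    have h2 : j v₀ ∈ f.ker ⊓ C := ⟨h1, hTC (hjT v₀)⟩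
    rw [hC.inf_eq_bot] at h2
    exact hv₀ (hinj v₀ h2)

lemma character_mem_irrSupport [Finite G] {d : ℕ} {π : Representation ℂ G (Fin d → ℂ)}
    [π.IsIrreducible] {W : Type*} [AddCommGroup W] [Module ℂ W] [FiniteDimensional ℂ W]
    {τ : Representation ℂ G W} (i : IntertwiningMap π τ) (hi : i ≠ 0) :
    π.character ∈ irrSupport τ.character := by
  have := Fintype.ofFinite G
  have : Invertible (Nat.card G : ℂ) :=
    invertibleOfNonzero (Nat.cast_ne_zero.2 Nat.card_pos.ne')
  refine ⟨⟨d, π, inferInstance, rfl⟩, ?_⟩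
  rw [irrMultiplicity, finsum_eq_sum_of_fintype, card_inv_mul_sum_char_mul_char_eq_finrank,
    Nat.cast_ne_zero]
  intro h0
  have : FiniteDimensional ℂ (IntertwiningMap π τ) :=
    Module.Finite.equiv (invariantsEquivIntertwiningMap π τ)
  have := Module.finrank_zero_iff.1 h0
  exact hi (Subsingleton.elim _ _)

/-- Representations with disjoint characters admit no nonzero intertwining map. -/
lemma intertwiningMap_eq_zero [Finite G] {V W : Type*}
    [AddCommGroup V] [Module ℂ V] [FiniteDimensional ℂ V]
    [AddCommGroup W] [Module ℂ W] [FiniteDimensional ℂ W]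
    {σ : Representation ℂ G V} {τ : Representation ℂ G W}
    (h : DisjointCharacters σ.character τ.character) (f : IntertwiningMap σ τ) : f = 0 := by
  by_contra hf
  obtain ⟨d, π, j, hπ, hj, hfj⟩ := exists_isIrreducible_of_intertwiningMap f hf
  exact Set.disjoint_left.1 h (character_mem_irrSupport j hj) (character_mem_irrSupport _ hfj)

lemma trace_pi_eq_sum {d : ℕ} (f : Module.End ℂ (Fin d → ℂ)) :
    LinearMap.trace ℂ _ f = ∑ p, f (Pi.single p 1) p := by
  rw [LinearMap.trace_eq_matrix_trace ℂ (Pi.basisFun ℂ (Fin d)), Matrix.trace]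
  simp

/-- Disjoint characters are orthogonal under convolution, also after translation. -/
lemma sum_mul_eq_zero_of_disjoint [Fintype G] {θ θ' : G → ℂ} (hθ : IsCharacter θ)
    (hθ' : IsCharacter θ') (h : DisjointCharacters θ θ') (a b : G) :
    ∑ r, θ' (a * r) * θ (r⁻¹ * b) = 0 := by
  obtain ⟨d, σ, rfl⟩ := hθ
  obtain ⟨d', τ, rfl⟩ := hθ'
  have key : ∀ X : (Fin d → ℂ) →ₗ[ℂ] (Fin d' → ℂ), ∑ r, τ r ∘ₗ X ∘ₗ σ r⁻¹ = 0 := fun X => by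
    let f : IntertwiningMap σ τ :=
      (∑ r, τ r ∘ₗ X ∘ₗ σ r⁻¹).intertwiningMap_of_isIntertwiningMap σ τ fun g v => by
        simp only [LinearMap.sum_apply, LinearMap.comp_apply, map_sum, ← Module.End.mul_apply,
          ← map_mul]
        exact Fintype.sum_equiv (Equiv.mulLeft g⁻¹) _ _ fun r => by simp
    exact congrArg IntertwiningMap.toLinearMap (intertwiningMap_eq_zero h f)
  simp only [Representation.character, map_mul, trace_pi_eq_sum, Finset.sum_mul_sum]
  rw [Finset.sum_comm]
  refine Finset.sum_eq_zero fun p _ => ?_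
  rw [Finset.sum_comm]
  refine Finset.sum_eq_zero fun q _ => ?_
  -- the rank one operator `e_q ↦ e_p` turns the product of diagonal entries into a single entry
  have h1 := congrFun (congrArg (τ a) (LinearMap.congr_fun
    (key ((LinearMap.proj q).smulRight (Pi.single p 1))) (σ b (Pi.single q 1)))) p
  simp only [LinearMap.sum_apply, LinearMap.comp_apply, map_sum, LinearMap.smulRight_apply,
    LinearMap.proj_apply, map_smul, LinearMap.zero_apply, map_zero, Finset.sum_apply,
    Pi.smul_apply, smul_eq_mul, Pi.zero_apply] at h1
  rw [← h1]
  exact Finset.sum_congr rfl fun r _ => mul_comm _ _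

end Disjoint

end CharacterTheory

/-! ### The subgroup `S` and orbits of linear forms -/

section LinearForms

variable {F : Type*} [Field F] {n : ℕ} {c : Composition n}

lemma Ad_mul_apply (a b : P c F) (x : J c F) : Ad (a * b) x = Ad a (Ad b x) :=
  Subtype.ext (by simp [Matrix.mul_assoc])

lemma Ad_one_apply (x : J c F) : Ad 1 x = x := Subtype.ext (by simp)

lemma Ad_Ad_inv (g : P c F) (x : J c F) : Ad g (Ad g⁻¹ x) = x := by
  rw [← Ad_mul_apply, mul_inv_cancel, Ad_one_apply]

lemma Ad_map_mul (g : P c F) (x y : J c F) : Ad g (x * y) = Ad g x * Ad g y := by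
  refine Subtype.ext ?_
  have h : ∀ A : Matrix (Fin n) (Fin n) F, g⁻¹.mat * (g.mat * A) = A := fun A => by
    rw [← Matrix.mul_assoc, P.mat_inv_mul, Matrix.one_mul]
  simp [Matrix.mul_assoc, h]

lemma index_mono {i j : Fin n} (h : i ≤ j) : c.index i ≤ c.index j := by
  by_contra! h'
  have h1 := c.lt_sizeUpTo_index_succ j
  have h2 := c.sizeUpTo_index_le i
  have h3 : c.sizeUpTo (c.index j).succ ≤ c.sizeUpTo (c.index i) :=
    c.monotone_sizeUpTo h'
  have h4 : (i : ℕ) ≤ j := h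
  omega

/-- Every `1 + y` with `y` in `J` belongs to `P`. -/
lemma exists_mat_eq_one_add (y : J c F) :
    ∃ u : P c F, u.mat = 1 + (y : Matrix (Fin n) (Fin n) F) := by
  have hdet : (1 + (y : Matrix (Fin n) (Fin n) F)).det = 1 := by
    rw [Matrix.det_of_isUpperTriangular]
    · simp [y.2 _ _ le_rfl]
    · intro i j hij
      have hij' : j < i := hij
      simp [y.2 i j (index_mono hij'.le), Matrix.one_apply_ne hij'.ne']
  refine ⟨⟨Matrix.GeneralLinearGroup.mk' _ (invertibleOfNonzero (by rw [hdet]; exact one_ne_zero)),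
    ?_⟩, rfl⟩
  intro i j hij
  change (1 + (y : Matrix (Fin n) (Fin n) F)) i j = 0
  have hne : i ≠ j := by rintro rfl; exact lt_irrefl _ hij
  simp [y.2 i j hij.le, Matrix.one_apply_ne hne]

lemma exists_inv_mat_eq_one_add {u : P c F} {y : J c F}
    (h : u.mat = 1 + (y : Matrix (Fin n) (Fin n) F)) :
    ∃ w : J c F, u⁻¹.mat = 1 + (w : Matrix (Fin n) (Fin n) F) := by
  refine ⟨-rmul u⁻¹ y, ?_⟩
  have := P.mat_mul_inv u
  rw [h, Matrix.add_mul, Matrix.one_mul] at this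
  simp [← this]

lemma rmul_of_mat_eq {u : P c F} {y : J c F} (h : u.mat = 1 + (y : Matrix (Fin n) (Fin n) F))
    (x : J c F) : rmul u x = x + x * y :=
  Subtype.ext (by simp [h, Matrix.mul_add])

lemma rmul_rmul_inv (u : P c F) (x : J c F) : rmul u (rmul u⁻¹ x) = x :=
  Subtype.ext (by simp [Matrix.mul_assoc, P.mat_inv_mul])

lemma mul_rmul (u : P c F) (x y : J c F) : x * rmul u y = rmul u (x * y) :=
  Subtype.ext (by simp [Matrix.mul_assoc])

/-- The linear map sending `y` to the form `x ↦ l (x y)`; its image has `Jrt l` as its common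
kernel. -/
def leftTranslates (l : Module.Dual F (J c F)) : J c F →ₗ[F] Module.Dual F (J c F) :=
  ((LinearMap.mul F (J c F)).compr₂ l).flip

@[simp] lemma leftTranslates_apply (l : Module.Dual F (J c F)) (x y : J c F) :
    leftTranslates l y x = l (x * y) := rfl

instance : FiniteDimensional F (J c F) :=
  FiniteDimensional.finiteDimensional_submodule (J c F).toSubmodule

lemma mem_of_forall_eq_zero {V : Type*} [AddCommGroup V] [Module F V] [FiniteDimensional F V]
    (W : Submodule F (Module.Dual F V)) {ν : Module.Dual F V}
    (h : ∀ x, (∀ φ ∈ W, φ x = 0) → ν x = 0) : ν ∈ W := by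
  rw [← Subspace.dualCoannihilator_dualAnnihilator_eq (W := W), Submodule.mem_dualAnnihilator]
  exact fun x hx => h x ((Submodule.mem_dualCoannihilator _).1 hx)

/-- The group `S l` consists of the `g` whose action moves `l` inside its orbit under left
translations by `1 + J`. -/
lemma mem_S_iff {l : Module.Dual F (J c F)} {g : P c F} :
    g ∈ S l ↔ ∃ z : J c F, ∀ x, l (Ad g x) = l x + l (x * z) := by
  constructor
  · intro hg
    have h : l ∘ₗ Ad g - l ∈ LinearMap.range (leftTranslates l) := by
      refine mem_of_forall_eq_zero _ fun x hx => ?_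
      have hx' : x ∈ Jrt l := fun y => hx _ ⟨y, rfl⟩
      simp [hg.2 x hx']
    obtain ⟨z, hz⟩ := h
    refine ⟨z, fun x => ?_⟩
    have := LinearMap.congr_fun hz x
    simp only [leftTranslates_apply, LinearMap.sub_apply, LinearMap.comp_apply] at this
    rw [this, add_sub_cancel]
  · rintro ⟨z, hz⟩
    refine ⟨fun x => ?_, fun x hx => by rw [hz, hx z, add_zero]⟩
    obtain ⟨u, hu⟩ := exists_mat_eq_one_add z
    have h1 : ∀ x y, l (Ad g x * Ad g y) = l (x * rmul u y) := fun x y => by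
      rw [← Ad_map_mul, hz, mul_rmul, rmul_of_mat_eq hu, map_add]
    constructor
    · intro hx y
      rw [← rmul_rmul_inv u y, ← h1]
      exact hx _
    · intro hx y
      rw [← Ad_Ad_inv g y, h1]
      exact hx _

/-- An element `g` for which `l` and its translate by `g` agree on `Jrt l ∩ g⁻¹ (Jrt l) g` lies in
`S l`: by duality the difference of the two forms is a sum of a left translate of one and a left
translate of the other, and then the orbits of both under `1 + J` coincide. -/
lemma mem_S_of_forall {l : Module.Dual F (J c F)} {g : P c F}
    (h : ∀ x ∈ Jrt l, Ad g x ∈ Jrt l → l (Ad g x) = l x) : g ∈ S l := by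
  have hmem : l ∘ₗ Ad g - l ∈
      LinearMap.range (leftTranslates l) ⊔ LinearMap.range (leftTranslates (l ∘ₗ Ad g)) := by
    refine mem_of_forall_eq_zero _ fun x hx => ?_
    have hx1 : x ∈ Jrt l := fun y => hx _ (Submodule.mem_sup_left ⟨y, rfl⟩)
    have hx2 : Ad g x ∈ Jrt l := fun y => by
      have := hx _ (Submodule.mem_sup_right ⟨Ad g⁻¹ y, rfl⟩)
      rwa [leftTranslates_apply, LinearMap.comp_apply, Ad_map_mul, Ad_Ad_inv] at this
    simp [h x hx1 hx2]
  obtain ⟨_, ⟨y, rfl⟩, _, ⟨y', rfl⟩, hy⟩ := Submodule.mem_sup.1 hmem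
  obtain ⟨u, hu⟩ := exists_mat_eq_one_add (-y')
  obtain ⟨v, hv⟩ := exists_mat_eq_one_add y
  obtain ⟨w, hw⟩ := exists_inv_mat_eq_one_add hu
  have key : ∀ x, l (Ad g (rmul u x)) = l (rmul v x) := fun x => by
    have := LinearMap.congr_fun hy x
    simp only [leftTranslates_apply, LinearMap.sub_apply, LinearMap.comp_apply,
      LinearMap.add_apply] at this
    have hneg : x * -y' = -(x * y') := Subtype.ext (by simp)
    rw [rmul_of_mat_eq hu, rmul_of_mat_eq hv, hneg, map_add, map_neg, map_add, map_add, map_neg]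
    linear_combination -this
  rw [mem_S_iff]
  refine ⟨w + y + w * y, fun x => ?_⟩
  rw [← map_add, ← rmul_rmul_inv u x, key, rmul_rmul_inv u x, rmul_of_mat_eq hv,
    rmul_of_mat_eq hw]
  congr 1
  noncomm_ring

end LinearForms

/-! ### Block triangular matrices -/

section BlockMatrices

variable {F : Type*} [Field F] {n : ℕ} {c : Composition n}

lemma single_mem_J {i j : Fin n} (h : c.index j < c.index i) :
    Matrix.single j i (1 : F) ∈ J c F := by
  intro p q hpq
  refine Matrix.single_apply_of_ne _ _ _ _ _ ?_
  rintro ⟨rfl, rfl⟩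
  exact absurd h hpq.not_gt

lemma apply_eq_of_forall_trace_eq {A B : Matrix (Fin n) (Fin n) F}
    (h : ∀ x ∈ J c F, (A * x).trace = (B * x).trace) {i j : Fin n}
    (hij : c.index j < c.index i) : A i j = B i j := by
  simpa [Matrix.trace_mul_single] using h _ (single_mem_J hij)

lemma trace_mul_eq_zero {A x : Matrix (Fin n) (Fin n) F}
    (h : ∀ i j, c.index j < c.index i → A i j = 0) (hx : x ∈ J c F) : (A * x).trace = 0 := by
  simp only [Matrix.trace, Matrix.diag, Matrix.mul_apply]
  refine Finset.sum_eq_zero fun i _ => Finset.sum_eq_zero fun j _ => ?_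
  rcases lt_or_ge (c.index j) (c.index i) with hij | hij
  · rw [h i j hij, zero_mul]
  · rw [hx j i hij, mul_zero]

/-- A strictly block lower triangular matrix such that the nonzero entries of each row, and those
of each column, lie in a single block. -/
structure IsBlockMonomial (c : Composition n) (L : Matrix (Fin n) (Fin n) F) : Prop where
  lt : ∀ {i j}, L i j ≠ 0 → c.index j < c.index i
  row : ∀ {i j j'}, L i j ≠ 0 → L i j' ≠ 0 → c.index j = c.index j'
  col : ∀ {i i' j}, L i j ≠ 0 → L i' j ≠ 0 → c.index i = c.index i'

/-- The block diagonal part of a matrix. -/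
def blockDiag (c : Composition n) (A : Matrix (Fin n) (Fin n) F) : Matrix (Fin n) (Fin n) F :=
  Matrix.of fun i j => if c.index i = c.index j then A i j else 0

lemma blockDiag_apply_eq {A : Matrix (Fin n) (Fin n) F} {i j : Fin n}
    (h : c.index i = c.index j) : blockDiag c A i j = A i j := by simp [blockDiag, h]

lemma blockDiag_apply_ne {A : Matrix (Fin n) (Fin n) F} {i j : Fin n}
    (h : c.index i ≠ c.index j) : blockDiag c A i j = 0 := by simp [blockDiag, h]

lemma blockDiag_one : blockDiag c (1 : Matrix (Fin n) (Fin n) F) = 1 := by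
  ext i j
  by_cases h : c.index i = c.index j
  · rw [blockDiag_apply_eq h]
  · rw [blockDiag_apply_ne h, Matrix.one_apply_ne (fun e => h (congrArg _ e))]

lemma blockDiag_mul {A B : Matrix (Fin n) (Fin n) F} (hA : A.BlockTriangular c.index)
    (hB : B.BlockTriangular c.index) : blockDiag c (A * B) = blockDiag c A * blockDiag c B := by
  ext i j
  rw [Matrix.mul_apply]
  by_cases h : c.index i = c.index j
  · rw [blockDiag_apply_eq h, Matrix.mul_apply]
    refine Finset.sum_congr rfl fun k _ => ?_
    rcases lt_trichotomy (c.index k) (c.index i) with hk | hk | hk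
    · rw [hA hk, blockDiag_apply_ne hk.ne', zero_mul, zero_mul]
    · rw [blockDiag_apply_eq hk.symm, blockDiag_apply_eq (hk.trans h)]
    · rw [hB (h ▸ hk), blockDiag_apply_ne hk.ne, mul_zero, zero_mul]
  · rw [blockDiag_apply_ne h]
    refine (Finset.sum_eq_zero fun k _ => ?_).symm
    by_cases hk : c.index i = c.index k
    · rw [blockDiag_apply_ne (A := B) (fun e => h (hk.trans e)), mul_zero]
    · rw [blockDiag_apply_ne hk, zero_mul]

section Core

variable {L g h f : Matrix (Fin n) (Fin n) F}

/-- If `L g` and `h L` agree below the block diagonal, then `L g f` vanishes there for every block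
diagonal `f` with `L f = 0`. -/
lemma mul_mul_apply_eq_zero
    (hgh : ∀ i j, c.index j < c.index i → (L * g) i j = (h * L) i j)
    (hf : ∀ i j, c.index i ≠ c.index j → f i j = 0) (hLf : L * f = 0) (i j : Fin n)
    (hij : c.index j < c.index i) : (L * g * f) i j = 0 := by
  have h1 : (h * L * f) i j = 0 := by rw [Matrix.mul_assoc, hLf, Matrix.mul_zero]; rfl
  rw [← h1, Matrix.mul_apply, Matrix.mul_apply]
  refine Finset.sum_congr rfl fun k _ => ?_
  by_cases hk : c.index k = c.index j
  · rw [hgh i k (hk ▸ hij)]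
  · rw [hf k j hk, mul_zero, mul_zero]

/-- The block diagonal part of `g` preserves the kernel of `L`, expressed through block diagonal `f`
with image in that kernel. In row `i` the nonzero entries of `L` lie in a single block, where `g`
may be replaced by its block diagonal part. -/
lemma mul_blockDiag_mul_eq_zero (hL : IsBlockMonomial c L)
    (hgh : ∀ i j, c.index j < c.index i → (L * g) i j = (h * L) i j)
    (hf : ∀ i j, c.index i ≠ c.index j → f i j = 0) (hLf : L * f = 0) :
    L * blockDiag c g * f = 0 := by
  ext i j
  rw [Matrix.zero_apply]
  by_cases hex : ∃ k, L i k ≠ 0 ∧ c.index k = c.index j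
  · obtain ⟨k, hk, hkj⟩ := hex
    rw [← mul_mul_apply_eq_zero hgh hf hLf i j (hkj ▸ hL.lt hk), Matrix.mul_apply,
      Matrix.mul_apply]
    refine Finset.sum_congr rfl fun m _ => ?_
    by_cases hm : c.index m = c.index j
    · congr 1
      rw [Matrix.mul_apply, Matrix.mul_apply]
      refine Finset.sum_congr rfl fun p _ => ?_
      by_cases hp : L i p = 0
      · rw [hp, zero_mul, zero_mul]
      · rw [blockDiag_apply_eq ((hL.row hp hk).trans (hkj.trans hm.symm))]
    · rw [hf m j hm, mul_zero, mul_zero]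
  · push Not at hex
    rw [Matrix.mul_apply]
    refine Finset.sum_eq_zero fun m _ => ?_
    by_cases hm : c.index m = c.index j
    · rw [Matrix.mul_apply, Finset.sum_eq_zero, zero_mul]
      intro p _
      by_cases hp : L i p = 0
      · rw [hp, zero_mul]
      · rw [blockDiag_apply_ne (hm ▸ hex p hp), mul_zero]
    · rw [hf m j hm, mul_zero]

/-- The block diagonal part of `g` preserves the image of `L`, expressed through block diagonal `f`
vanishing on that image. -/
lemma mul_blockDiag_mul_eq_zero' (hL : IsBlockMonomial c L)
    (hgh : ∀ i j, c.index j < c.index i → (L * g) i j = (h * L) i j)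
    (hd : ∀ i j, c.index i = c.index j → g i j = h i j)
    (hf : ∀ i j, c.index i ≠ c.index j → f i j = 0) (hfL : f * L = 0) :
    f * (blockDiag c g * L) = 0 := by
  ext i j
  rw [Matrix.zero_apply]
  by_cases hex : ∃ k, L k j ≠ 0 ∧ c.index k = c.index i
  · obtain ⟨k, hk, hki⟩ := hex
    have h0 : (f * (L * g)) i j = 0 := by rw [← Matrix.mul_assoc, hfL, Matrix.zero_mul]; rfl
    rw [← h0, Matrix.mul_apply, Matrix.mul_apply]
    refine Finset.sum_congr rfl fun m _ => ?_
    by_cases hm : c.index i = c.index m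
    · rw [hgh m j (hm ▸ hki ▸ hL.lt hk)]
      congr 1
      rw [Matrix.mul_apply, Matrix.mul_apply]
      refine Finset.sum_congr rfl fun p _ => ?_
      by_cases hp : L p j = 0
      · rw [hp, mul_zero, mul_zero]
      · have hmp : c.index m = c.index p := hm.symm.trans (hki.symm.trans (hL.col hk hp))
        rw [blockDiag_apply_eq hmp, hd m p hmp]
    · rw [hf i m hm, zero_mul, zero_mul]
  · push Not at hex
    rw [Matrix.mul_apply]
    refine Finset.sum_eq_zero fun m _ => ?_
    by_cases hm : c.index i = c.index m
    · rw [Matrix.mul_apply, Finset.sum_eq_zero, mul_zero]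
      intro p _
      by_cases hp : L p j = 0
      · rw [hp, mul_zero]
      · rw [blockDiag_apply_ne (fun e => hex p hp (hm.trans e).symm), zero_mul]
    · rw [hf i m hm, zero_mul]

end Core

lemma P.blockTriangular (g : P c F) : g.mat.BlockTriangular c.index := g.2

/-- The block diagonal part of an element of `P`, as an element of `P`. -/
def diagPart (g : P c F) : P c F :=
  ⟨⟨blockDiag c g.mat, blockDiag c g⁻¹.mat,
    by rw [← blockDiag_mul g.blockTriangular g⁻¹.blockTriangular, P.mat_mul_inv, blockDiag_one],
    by rw [← blockDiag_mul g⁻¹.blockTriangular g.blockTriangular, P.mat_inv_mul, blockDiag_one]⟩,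
    fun _ _ h => blockDiag_apply_ne h.ne'⟩

lemma diagPart_mem_R (g : P c F) : diagPart g ∈ R c F := fun _ _ h => blockDiag_apply_ne h

lemma blockDiag_mat_of_mem_R {r : P c F} (hr : r ∈ R c F) : blockDiag c r.mat = r.mat := by
  ext i j
  by_cases h : c.index i = c.index j
  · rw [blockDiag_apply_eq h]
  · rw [blockDiag_apply_ne h, hr i j h]

lemma sub_blockDiag_mem_J (g : P c F) : g.mat - blockDiag c g.mat ∈ J c F := by
  intro i j h
  rw [Matrix.sub_apply]
  rcases h.lt_or_eq with h | h
  · rw [g.mat_apply_eq_zero h, blockDiag_apply_ne h.ne', sub_zero]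
  · rw [blockDiag_apply_eq h.symm, sub_self]

end BlockMatrices

/-! ### The action of `S` on `R°` -/

section Placements

variable {F : Type*} [Field F] {n : ℕ} {c : Composition n}

lemma exists_isBlockMonomial {D : BlockRookPlacement c} {l : Module.Dual F (J c F)}
    (hl : IsAssociated D l) : ∃ L : Matrix (Fin n) (Fin n) F, IsBlockMonomial c L ∧
      ∀ x : J c F, l x = (L * (x : Matrix (Fin n) (Fin n) F)).trace := by
  classical
  obtain ⟨a, ha, -⟩ := hl
  have hroot : ∀ {i j}, (if (j, i) ∈ D.roots then a j i else 0) ≠ 0 →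
      ∃ p ∈ D.rooks, j ∈ p.1 ∧ i ∈ p.2 := fun {i j} h => by
    have : (j, i) ∈ D.roots := by by_contra h'; simp [h'] at h
    simpa [BlockRookPlacement.roots] using this
  refine ⟨Matrix.of fun i j => if (j, i) ∈ D.roots then a j i else 0, ⟨?_, ?_, ?_⟩, fun x => ?_⟩
  · intro i j h
    obtain ⟨p, hp, hj, hi⟩ := hroot h
    obtain ⟨-, k, m, hkm, hk, hm⟩ := D.isBlockRook p hp
    rw [hk j hj, hm i hi]
    exact hkm
  · intro i j j' h h'
    obtain ⟨p, hp, hj, hi⟩ := hroot h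
    obtain ⟨q, hq, hj', hi'⟩ := hroot h'
    have hpq : p = q := by
      by_contra hne
      exact Finset.disjoint_left.1 (D.nonattacking p hp q hq hne).2 hi hi'
    subst hpq
    obtain ⟨-, k, m, hkm, hk, hm⟩ := D.isBlockRook p hp
    rw [hk j hj, hk j' hj']
  · intro i i' j h h'
    obtain ⟨p, hp, hj, hi⟩ := hroot h
    obtain ⟨q, hq, hj', hi'⟩ := hroot h'
    have hpq : p = q := by
      by_contra hne
      exact Finset.disjoint_left.1 (D.nonattacking p hp q hq hne).1 hj hj'
    subst hpq
    obtain ⟨-, k, m, hkm, hk, hm⟩ := D.isBlockRook p hp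
    rw [hm i hi, hm i' hi']
  · rw [ha]
    simp only [Matrix.trace, Matrix.diag, Matrix.mul_apply, Matrix.of_apply, ite_mul, zero_mul]
    rw [Finset.sum_comm, ← Fintype.sum_prod_type' (f := fun j i =>
      if (j, i) ∈ D.roots then a j i * (x : Matrix (Fin n) (Fin n) F) j i else 0)]
    simp

variable {l : Module.Dual F (J c F)} {L : Matrix (Fin n) (Fin n) F}

lemma mul_sub_one_eq_zero (hL : IsBlockMonomial c L)
    (hl : ∀ x : J c F, l x = (L * (x : Matrix (Fin n) (Fin n) F)).trace) {r : P c F}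
    (hr : r ∈ Rcirc l) : L * (r.mat - 1) = 0 := by
  ext i j
  rw [Matrix.zero_apply]
  rcases lt_or_ge (c.index j) (c.index i) with hij | hij
  · refine apply_eq_of_forall_trace_eq (B := 0) (fun x hx => ?_) hij
    have h1 : l (lmul r ⟨x, hx⟩) = l ⟨x, hx⟩ := LinearMap.congr_fun hr.1.2 ⟨x, hx⟩
    rw [hl, hl, coe_lmul] at h1
    rw [Matrix.mul_sub, Matrix.sub_mul, Matrix.trace_sub, Matrix.mul_assoc, h1]
    simp
  · rw [Matrix.mul_apply]
    refine Finset.sum_eq_zero fun k _ => ?_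
    by_cases hk : L i k = 0
    · rw [hk, zero_mul]
    · have hkj : c.index k ≠ c.index j := ((hL.lt hk).trans_le hij).ne
      rw [Matrix.sub_apply, hr.1.1 k j hkj, Matrix.one_apply_ne (fun e => hkj (congrArg _ e)),
        sub_zero, mul_zero]

lemma sub_one_mul_eq_zero (hL : IsBlockMonomial c L)
    (hl : ∀ x : J c F, l x = (L * (x : Matrix (Fin n) (Fin n) F)).trace) {r : P c F}
    (hr : r ∈ Rcirc l) : (r.mat - 1) * L = 0 := by
  ext i j
  rw [Matrix.zero_apply]
  rcases lt_or_ge (c.index j) (c.index i) with hij | hij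
  · refine apply_eq_of_forall_trace_eq (B := 0) (fun x hx => ?_) hij
    have h1 : l (rmul r ⟨x, hx⟩) = l ⟨x, hx⟩ := LinearMap.congr_fun hr.2.2 ⟨x, hx⟩
    rw [hl, hl, coe_rmul] at h1
    rw [Matrix.sub_mul, Matrix.sub_mul, Matrix.trace_sub, Matrix.mul_assoc, Matrix.trace_mul_comm,
      Matrix.mul_assoc, h1]
    simp
  · rw [Matrix.mul_apply]
    refine Finset.sum_eq_zero fun k _ => ?_
    by_cases hk : L k j = 0
    · rw [hk, mul_zero]
    · have hik : c.index i ≠ c.index k := (hij.trans_lt (hL.lt hk)).ne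
      rw [Matrix.sub_apply, hr.1.1 i k hik, Matrix.one_apply_ne (fun e => hik (congrArg _ e)),
        sub_zero, zero_mul]

lemma mem_Rcirc_of_mul_eq_zero
    (hl : ∀ x : J c F, l x = (L * (x : Matrix (Fin n) (Fin n) F)).trace) {r : P c F}
    (hr : r ∈ R c F) (h1 : L * (r.mat - 1) = 0) (h2 : (r.mat - 1) * L = 0) : r ∈ Rcirc l := by
  rw [Matrix.mul_sub, sub_eq_zero, Matrix.mul_one] at h1
  rw [Matrix.sub_mul, sub_eq_zero, Matrix.one_mul] at h2
  refine ⟨⟨hr, LinearMap.ext fun x => ?_⟩, ⟨hr, LinearMap.ext fun x => ?_⟩⟩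
  · rw [rightAct, LinearMap.comp_apply, hl, hl, coe_lmul, ← Matrix.mul_assoc, h1]
  · rw [leftAct, LinearMap.comp_apply, hl, hl, coe_rmul, ← Matrix.mul_assoc, Matrix.trace_mul_comm,
      ← Matrix.mul_assoc, h2]

/-- The matrix form of membership in `S l`: up to the block diagonal, `L` intertwines `g` with a
matrix having the same block diagonal part. -/
lemma exists_mul_apply_eq (hl : ∀ x : J c F, l x = (L * (x : Matrix (Fin n) (Fin n) F)).trace)
    {g : P c F} (hg : g ∈ S l) : ∃ h : Matrix (Fin n) (Fin n) F,
      (∀ i j, c.index j < c.index i → (L * g.mat) i j = (h * L) i j) ∧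
      ∀ i j, c.index i = c.index j → g.mat i j = h i j := by
  obtain ⟨z, hz⟩ := mem_S_iff.1 hg
  refine ⟨g.mat + g.mat * (z : Matrix (Fin n) (Fin n) F), fun i j hij => ?_, fun i j hij => ?_⟩
  · refine apply_eq_of_forall_trace_eq (fun x hx => ?_) hij
    have h1 := hz (rmul g ⟨x, hx⟩)
    rw [hl, hl, hl] at h1
    simp only [coe_Ad, coe_rmul, NonUnitalSubalgebra.coe_mul, Matrix.mul_assoc, P.mat_mul_inv,
      Matrix.mul_one] at h1
    rw [Matrix.mul_assoc, h1, ← Matrix.trace_add, Matrix.mul_assoc, Matrix.trace_mul_comm _ (L * x)]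
    simp only [Matrix.mul_add, Matrix.mul_assoc]
  · have : (g.mat * (z : Matrix (Fin n) (Fin n) F)) i j = 0 := (lmul g z).2 i j hij.ge
    rw [Matrix.add_apply, this, add_zero]

/-- The group `S l` normalizes `PD l`: conjugation by `g` in `S l` takes an element `r` of `R°` to
some `r' + x` with `r'` in `R°`, `x` in `Jrt l` and `l x = 0`. Here `r'` is the conjugate of `r` by
the block diagonal part of `g`. -/
lemma exists_conj_eq (hL : IsBlockMonomial c L)
    (hl : ∀ x : J c F, l x = (L * (x : Matrix (Fin n) (Fin n) F)).trace) {g : P c F}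
    (hg : g ∈ S l) (r : Rcirc l) : ∃ (r' : Rcirc l) (x : Jrt l),
      (g * (r : P c F) * g⁻¹).mat = (r' : P c F).mat + ((x : J c F) : Matrix (Fin n) (Fin n) F) ∧
      l (x : J c F) = 0 := by
  obtain ⟨h, hgh, -⟩ := exists_mul_apply_eq hl hg
  obtain ⟨k, hgk, hd⟩ := exists_mul_apply_eq hl (inv_mem hg)
  set f := (r : P c F).mat - 1 with hf_def
  have hf : ∀ i j, c.index i ≠ c.index j → f i j = 0 := fun i j hij => by
    rw [hf_def, Matrix.sub_apply, r.2.1.1 i j hij,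
      Matrix.one_apply_ne (fun e => hij (congrArg _ e)), sub_zero]
  have hLf := mul_sub_one_eq_zero hL hl r.2
  have hfL := sub_one_mul_eq_zero hL hl r.2
  have hr : (r : P c F).mat = 1 + f := by rw [hf_def]; abel
  set s := diagPart g
  have hr' : (s * r * s⁻¹).mat - 1 = s.mat * f * s⁻¹.mat := by
    rw [P.mat_mul, P.mat_mul, hr, Matrix.mul_add, Matrix.add_mul, Matrix.mul_one, P.mat_mul_inv]
    abel
  have hgr : (g * r * g⁻¹).mat = 1 + g.mat * f * g⁻¹.mat := by
    rw [P.mat_mul, P.mat_mul, hr, Matrix.mul_add, Matrix.add_mul, Matrix.mul_one, P.mat_mul_inv]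
  have h1 : L * s.mat * f = 0 := mul_blockDiag_mul_eq_zero hL hgh hf hLf
  have h2 : f * (s⁻¹.mat * L) = 0 := mul_blockDiag_mul_eq_zero' hL hgk hd hf hfL
  have h3 : L * ((s * r * s⁻¹).mat - 1) = 0 := by
    rw [hr', ← Matrix.mul_assoc, ← Matrix.mul_assoc, h1, Matrix.zero_mul]
  have h4 : ((s * r * s⁻¹).mat - 1) * L = 0 := by
    rw [hr', Matrix.mul_assoc, Matrix.mul_assoc, h2, Matrix.mul_zero]
  have hsR : s * r * s⁻¹ ∈ R c F :=
    mul_mem (mul_mem (diagPart_mem_R g) r.2.1.1) (inv_mem (diagPart_mem_R g))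
  have hbd : blockDiag c (g * r * g⁻¹).mat = (s * r * s⁻¹).mat := by
    rw [P.mat_mul, blockDiag_mul (g * r).blockTriangular g⁻¹.blockTriangular, P.mat_mul,
      blockDiag_mul g.blockTriangular (r : P c F).blockTriangular, blockDiag_mat_of_mem_R r.2.1.1]
    rfl
  have hx : (g * r * g⁻¹).mat - (s * r * s⁻¹).mat ∈ J c F := hbd ▸ sub_blockDiag_mem_J _
  have hLx : L * ((g * r * g⁻¹).mat - (s * r * s⁻¹).mat) = L * g.mat * f * g⁻¹.mat := by
    have : (g * r * g⁻¹).mat - (s * r * s⁻¹).mat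
        = g.mat * f * g⁻¹.mat - ((s * r * s⁻¹).mat - 1) := by rw [hgr]; abel
    rw [this, Matrix.mul_sub, h3, sub_zero]
    simp only [Matrix.mul_assoc]
  have hLgf := mul_mul_apply_eq_zero hgh hf hLf
  refine ⟨⟨s * r * s⁻¹, mem_Rcirc_of_mul_eq_zero hl hsR h3 h4⟩, ⟨⟨_, hx⟩, fun y => ?_⟩,
    (add_sub_cancel _ _).symm, ?_⟩
  · rw [hl, NonUnitalSubalgebra.coe_mul, ← Matrix.mul_assoc, hLx, Matrix.mul_assoc]
    exact trace_mul_eq_zero hLgf (lmul g⁻¹ y).2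
  · -- below the block diagonal `L g f` vanishes, so only the block diagonal part of `g⁻¹` matters
    have h5 : L * g.mat * f * g⁻¹.mat = L * g.mat * f * s⁻¹.mat
        + L * g.mat * f * (g⁻¹.mat - blockDiag c g⁻¹.mat) := by
      rw [← Matrix.mul_add]
      congr 1
      exact (add_sub_cancel _ _).symm
    rw [hl, hLx, h5, Matrix.trace_add, trace_mul_eq_zero hLgf (sub_blockDiag_mem_J g⁻¹), add_zero,
      Matrix.mul_assoc L, Matrix.mul_assoc L, Matrix.trace_mul_comm, Matrix.mul_assoc,
      Matrix.mul_assoc, h2, Matrix.mul_zero, Matrix.trace_zero]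

end Placements

/-! ### The characters `xi` extended by zero -/

section ExtendedXi

variable {F : Type*} [Field F] {n : ℕ} {c : Composition n} {l : Module.Dual F (J c F)}
  {ε : AddChar F ℂ} {θ : Rcirc l → ℂ}

instance [Finite F] : Finite (P c F) :=
  Finite.of_injective P.mat fun _ _ h => Subtype.ext (Units.ext h)

lemma extendZero_xi_eq {g : P c F} (r : Rcirc l) {x : J c F} (hx : x ∈ Jrt l)
    (h : g.mat = (r : P c F).mat + (x : Matrix (Fin n) (Fin n) F)) :
    extendZero (PD l) (xi ε l θ) g = θ r * ε (l x) := by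
  have hg : g ∈ PD l := ⟨r, ⟨x, hx⟩, h⟩
  exact (extendZero_of_mem ⟨g, hg⟩).trans (xi_eq ε l θ ⟨g, hg⟩ r ⟨x, hx⟩ h)

lemma mem_PD_of_mat_eq_one_add {u : P c F} {x : J c F} (hx : x ∈ Jrt l)
    (hu : u.mat = 1 + (x : Matrix (Fin n) (Fin n) F)) : u ∈ PD l :=
  ⟨1, ⟨x, hx⟩, hu⟩

lemma mem_PD_of_mem_Rcirc (r : Rcirc l) : (r : P c F) ∈ PD l :=
  ⟨r, 0, by simp⟩

lemma apply_lmul_Rcirc (r : Rcirc l) (x : J c F) : l (lmul r x) = l x :=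
  LinearMap.congr_fun r.2.1.2 x

lemma apply_rmul_Rcirc (r : Rcirc l) (x : J c F) : l (rmul r x) = l x :=
  LinearMap.congr_fun r.2.2.2 x

lemma extendZero_xi_mul {u : P c F} {x : J c F} (hx : x ∈ Jrt l)
    (hu : u.mat = 1 + (x : Matrix (Fin n) (Fin n) F)) (g : P c F) :
    extendZero (PD l) (xi ε l θ) (g * u) = ε (l x) * extendZero (PD l) (xi ε l θ) g := by
  by_cases hg : g ∈ PD l
  · obtain ⟨r, y, h⟩ := hg
    rw [extendZero_xi_eq r y.2 h,
      extendZero_xi_eq r (x := (y : J c F) + lmul (r : P c F) x + y * x), map_add l, map_add l,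
      y.2, add_zero, apply_lmul_Rcirc, AddChar.map_add_eq_mul]
    · ring
    · refine add_mem (add_mem y.2 (lmul_mem_Jrt r.2 hx)) ?_
      intro z
      rw [mul_assoc]
      exact y.2 _
    · rw [P.mat_mul, h, hu]
      simp only [NonUnitalSubalgebra.coe_add, NonUnitalSubalgebra.coe_mul, coe_lmul,
        Matrix.add_mul, Matrix.mul_add, Matrix.mul_one]
      abel
  · have hgu : g * u ∉ PD l := fun h =>
      hg ((Subgroup.mul_mem_cancel_right _ (mem_PD_of_mat_eq_one_add hx hu)).1 h)
    rw [extendZero_of_notMem hg, extendZero_of_notMem hgu, mul_zero]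

lemma extendZero_xi_mul' {u : P c F} {x : J c F} (hx : x ∈ Jrt l)
    (hu : u.mat = 1 + (x : Matrix (Fin n) (Fin n) F)) (g : P c F) :
    extendZero (PD l) (xi ε l θ) (u * g) = ε (l x) * extendZero (PD l) (xi ε l θ) g := by
  by_cases hg : g ∈ PD l
  · obtain ⟨r, y, h⟩ := hg
    rw [extendZero_xi_eq r y.2 h,
      extendZero_xi_eq r (x := (y : J c F) + rmul (r : P c F) x + x * y), map_add l, map_add l,
      hx, add_zero, apply_rmul_Rcirc, AddChar.map_add_eq_mul]
    · ring
    · refine add_mem (add_mem y.2 (rmul_mem_Jrt _ hx)) ?_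
      intro z
      rw [mul_assoc]
      exact hx _
    · rw [P.mat_mul, h, hu]
      simp only [NonUnitalSubalgebra.coe_add, NonUnitalSubalgebra.coe_mul, coe_rmul,
        Matrix.add_mul, Matrix.mul_add, Matrix.one_mul]
      abel
  · have hgu : u * g ∉ PD l := fun h =>
      hg ((Subgroup.mul_mem_cancel_left _ (mem_PD_of_mat_eq_one_add hx hu)).1 h)
    rw [extendZero_of_notMem hg, extendZero_of_notMem hgu, mul_zero]

lemma extendZero_xi_mul_Rcirc {g : P c F} (a r : Rcirc l) {x : J c F} (hx : x ∈ Jrt l)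
    (h : g.mat = (a : P c F).mat + (x : Matrix (Fin n) (Fin n) F)) :
    extendZero (PD l) (xi ε l θ) (g * r) = θ (a * r) * ε (l x) := by
  rw [extendZero_xi_eq (a * r) (rmul_mem_Jrt (r : P c F) hx), apply_rmul_Rcirc]
  rw [P.mat_mul, h, Matrix.add_mul]
  rfl

lemma extendZero_xi_Rcirc_mul {g : P c F} (b r : Rcirc l) {x : J c F} (hx : x ∈ Jrt l)
    (h : g.mat = (b : P c F).mat + (x : Matrix (Fin n) (Fin n) F)) :
    extendZero (PD l) (xi ε l θ) (r * g) = θ (r * b) * ε (l x) := by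
  rw [extendZero_xi_eq (r * b) (lmul_mem_Jrt r.2 hx), apply_lmul_Rcirc]
  rw [P.mat_mul, h, Matrix.mul_add]
  rfl

variable {L : Matrix (Fin n) (Fin n) F}

/-- For `S`-invariant `θ` the function `xi` is invariant under conjugation by `S l`. -/
lemma extendZero_xi_conj (hL : IsBlockMonomial c L)
    (hl : ∀ x : J c F, l x = (L * (x : Matrix (Fin n) (Fin n) F)).trace)
    (hθ : SInvariant l θ) {g : P c F} (hg : g ∈ S l) (h : P c F) :
    extendZero (PD l) (xi ε l θ) (g * h * g⁻¹) = extendZero (PD l) (xi ε l θ) h := by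
  -- the identity for `h` in `PD l`, in a form that also shows that `PD l` is normalized
  have key : ∀ {g : P c F}, g ∈ S l → ∀ h ∈ PD l, g * h * g⁻¹ ∈ PD l ∧
      extendZero (PD l) (xi ε l θ) (g * h * g⁻¹) = extendZero (PD l) (xi ε l θ) h := by
    rintro g hg h ⟨r, x, hh⟩
    obtain ⟨r', y, hr', hy⟩ := exists_conj_eq hL hl hg r
    have hmem : (y : J c F) + Ad g x ∈ Jrt l := add_mem y.2 ((hg.1 x).2 x.2)
    have hmat : (g * h * g⁻¹).mat = (r' : P c F).mat
        + (((y : J c F) + Ad g x : J c F) : Matrix (Fin n) (Fin n) F) := by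
      rw [NonUnitalSubalgebra.coe_add, ← add_assoc, ← hr', coe_Ad]
      simp only [P.mat_mul, hh, Matrix.mul_add, Matrix.add_mul, Matrix.mul_assoc]
    refine ⟨⟨r', ⟨_, hmem⟩, hmat⟩, ?_⟩
    have hθr : θ r' = θ r := hθ g hg r r' (by
      rw [hr', add_sub_cancel_left]
      exact (y : J c F).2)
    rw [extendZero_xi_eq r' hmem hmat, extendZero_xi_eq r x.2 hh, map_add, hy, zero_add,
      hg.2 x x.2, hθr]
  by_cases hh : h ∈ PD l
  · exact (key hg h hh).2
  · have : g * h * g⁻¹ ∉ PD l := fun h' => hh (by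
      have := (key (inv_mem hg) _ h').1
      rwa [inv_inv, show g⁻¹ * (g * h * g⁻¹) * g = h by group] at this)
    rw [extendZero_of_notMem hh, extendZero_of_notMem this]

/-- The convolution of `xi` for two disjoint characters of `R°` vanishes: it is already zero after
summation over a coset of `R°`. -/
lemma sum_extendZero_xi_mul_eq_zero [Fintype (P c F)] {θ θ' : Rcirc l → ℂ} (hθ : IsCharacter θ)
    (hθ' : IsCharacter θ') (h : DisjointCharacters θ θ') (m : P c F) :
    ∑ k, extendZero (PD l) (xi ε l θ') k * extendZero (PD l) (xi ε l θ) (k⁻¹ * m) = 0 := by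
  have : Fintype (Rcirc l) := Fintype.ofFinite _
  set T := ∑ k, extendZero (PD l) (xi ε l θ') k * extendZero (PD l) (xi ε l θ) (k⁻¹ * m)
  have hT : ∀ r : Rcirc l, ∑ k : P c F, extendZero (PD l) (xi ε l θ') (k * r) *
      extendZero (PD l) (xi ε l θ) ((r⁻¹ : Rcirc l) * (k⁻¹ * m)) = T := fun r =>
    Fintype.sum_equiv (Equiv.mulRight (r : P c F)) _ _ fun k => by simp [mul_assoc]
  have hsum : (Fintype.card (Rcirc l) : ℂ) * T = 0 := by
    rw [← nsmul_eq_mul, ← Finset.card_univ, ← Finset.sum_const, ← Finset.sum_congr rfl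
      fun r _ => hT r, Finset.sum_comm]
    refine Finset.sum_eq_zero fun k _ => ?_
    by_cases hk : k ∈ PD l
    · by_cases hm : k⁻¹ * m ∈ PD l
      · obtain ⟨a, x, ha⟩ := hk
        obtain ⟨b, y, hb⟩ := hm
        have h0 := sum_mul_eq_zero_of_disjoint hθ hθ' h a b
        have h1 : ∀ r : Rcirc l, extendZero (PD l) (xi ε l θ') (k * r) *
            extendZero (PD l) (xi ε l θ) ((r⁻¹ : Rcirc l) * (k⁻¹ * m))
            = θ' (a * r) * θ (r⁻¹ * b) * (ε (l x) * ε (l y)) := fun r => by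
          rw [extendZero_xi_mul_Rcirc a r x.2 ha, extendZero_xi_Rcirc_mul b r⁻¹ y.2 hb]
          ring
        rw [Finset.sum_congr rfl fun r _ => h1 r, ← Finset.sum_mul, h0, zero_mul]
      · refine Finset.sum_eq_zero fun r _ => ?_
        rw [extendZero_of_notMem (g := (r⁻¹ : Rcirc l) * (k⁻¹ * m)), mul_zero]
        rwa [Subgroup.mul_mem_cancel_left _ (mem_PD_of_mem_Rcirc r⁻¹)]
    · refine Finset.sum_eq_zero fun r _ => ?_
      rw [extendZero_of_notMem (g := k * r), zero_mul]
      rwa [Subgroup.mul_mem_cancel_right _ (mem_PD_of_mem_Rcirc r)]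
  exact (mul_eq_zero.1 hsum).resolve_left (Nat.cast_ne_zero.2 Fintype.card_ne_zero)

/-- The operators of `xi` for two characters multiply to zero with any `g` outside `S l` between
them: two linear characters of a common subgroup of `1 + Jrt l` and its conjugate differ. -/
lemma funOperator_xi_mul_of_notMem_S [Fintype (P c F)] (hε : ε ≠ 1) {θ' : Rcirc l → ℂ}
    {V : Type*} [AddCommGroup V] [Module ℂ V] (ρ : Representation ℂ (P c F) V) {g : P c F}
    (hg : g ∉ S l) :
    funOperator ρ (extendZero (PD l) (xi ε l θ)) * ρ g *
      funOperator ρ (extendZero (PD l) (xi ε l θ')) = 0 := by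
  obtain ⟨x, hx, hgx, hne⟩ : ∃ x ∈ Jrt l, Ad g x ∈ Jrt l ∧ l (Ad g x) ≠ l x := by
    by_contra! h
    exact hg (mem_S_of_forall h)
  obtain ⟨t, ht⟩ : ∃ t, ε t ≠ 1 := by
    by_contra! h
    exact hε (DFunLike.ext _ _ h)
  -- rescale `x` so that the two values of `l` differ by an element outside the kernel of `ε`
  obtain ⟨y, hy, hgy, hyt⟩ : ∃ y ∈ Jrt l, Ad g y ∈ Jrt l ∧ l (Ad g y) = t + l y := by
    refine ⟨(t / (l (Ad g x) - l x)) • x, Submodule.smul_mem _ _ hx, ?_, ?_⟩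
    · rw [map_smul]
      exact Submodule.smul_mem _ _ hgx
    · have := sub_ne_zero.2 hne
      simp only [map_smul, smul_eq_mul]
      field_simp
      ring
  obtain ⟨u, hu⟩ := exists_mat_eq_one_add y
  have hu' : (g * u * g⁻¹).mat = 1 + ((Ad g y : J c F) : Matrix (Fin n) (Fin n) F) := by
    rw [P.mat_mul, P.mat_mul, hu, Matrix.mul_add, Matrix.add_mul, Matrix.mul_one, P.mat_mul_inv,
      coe_Ad, Matrix.mul_assoc]
  set A := funOperator ρ (extendZero (PD l) (xi ε l θ))
  set A' := funOperator ρ (extendZero (PD l) (xi ε l θ'))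
  have h1 : ρ u * A' = ε (l y) • A' := by
    rw [rep_mul_funOperator, funext (extendZero_xi_mul hy hu), funOperator_smul]
  have h2 : A * ρ (g * u * g⁻¹) = ε (l (Ad g y)) • A := by
    rw [funOperator_mul_rep, funext (extendZero_xi_mul' hgy hu'), funOperator_smul]
  have h3 : ε (l (Ad g y)) • (A * ρ g * A') = ε (l y) • (A * ρ g * A') := by
    rw [← smul_mul_assoc, ← smul_mul_assoc, ← h2, ← mul_smul_comm, ← h1, mul_assoc A, ← map_mul,
      mul_assoc A, mul_assoc A, ← mul_assoc (ρ g), ← map_mul, inv_mul_cancel_right]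
  rw [hyt, AddChar.map_add_eq_mul, mul_smul] at h3
  replace h3 : (ε t - 1) • ε (l y) • (A * ρ g * A') = 0 := by
    rw [sub_smul, one_smul, h3, sub_self]
  have h4 := (smul_eq_zero.1 h3).resolve_left (sub_ne_zero.2 ht)
  exact (smul_eq_zero.1 h4).resolve_left (ε.val_isUnit _).ne_zero

end ExtendedXi

end ParabolicSuper
end

theorem proposition18 {F : Type*} [Field F] [Finite F] {n : ℕ} (c : Composition n)
    (D : ParabolicSuper.BlockRookPlacement c)
    (l : Module.Dual F (ParabolicSuper.J c F)) (hl : ParabolicSuper.IsAssociated D l)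
    (ε : AddChar F ℂ) (hε : ε ≠ 1)
    (θ θ' : ParabolicSuper.Rcirc l → ℂ)
    (hθ : ParabolicSuper.IsCharacter θ) (hθ' : ParabolicSuper.IsCharacter θ')
    (hS : ParabolicSuper.SInvariant l θ) (hS' : ParabolicSuper.SInvariant l θ')
    (hdisj : ParabolicSuper.DisjointCharacters θ θ') :
    ParabolicSuper.DisjointCharacters (ParabolicSuper.chi ε l θ) (ParabolicSuper.chi ε l θ') := by
  open ParabolicSuper in
  have := Fintype.ofFinite (P c F)
  obtain ⟨L, hL, hlL⟩ := exists_isBlockMonomial hl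
  refine disjointCharacters_of_mul_eq_zero (inducedCharacter_mul_comm _ _)
    (inducedCharacter_mul_comm _ _) fun d ρ _ => ?_
  refine funOperator_inducedCharacter_mul_eq_zero ρ _ _ _ fun g => ?_
  by_cases hg : g ∈ S l
  · have hcomm : ρ g * funOperator ρ (extendZero (PD l) (xi ε l θ'))
        = funOperator ρ (extendZero (PD l) (xi ε l θ')) * ρ g := by
      rw [rep_mul_funOperator, funOperator_mul_rep]
      refine congrArg _ (funext fun h => ?_)
      rw [← extendZero_xi_conj hL hlL hS' hg (h * g), ← mul_assoc, mul_inv_cancel_right]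
    rw [mul_assoc, hcomm, ← mul_assoc, funOperator_mul,
      funext (sum_extendZero_xi_mul_eq_zero hθ hθ' hdisj), funOperator_zero, zero_mul]
  · exact funOperator_xi_mul_of_notMem_S hε ρ hg
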